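/- Let $m,n$ be positive integers. For a linear map $\Phi: M_m(\mathbb{C})\to M_n(\mathbb{C})$ let $\Phi^\dagger: M_n(\mathbb{C})\to M_m(\mathbb{C})$ denote its adjoint with respect to the Hilbert--Schmidt inner products $\langle X,Y\rangle=\operatorname{tr}[X^*Y]$. The map $\Phi$ is called a Schwarz map if $\Phi(X^*X)\ge \Phi(X)^*\Phi(X)$ in the Loewner order for all $X\in M_m(\mathbb{C})$, and sesquiunital if $\Phi(\mathbf 1)=\mathbf 1$ and $\Phi^\dagger(\mathbf 1)=\frac{n}{m}\mathbf 1$. Let $0<s\le 1$ and $s\le r\le 1$, and let $\Phi: M_m(\mathbb{C})\to M_n(\mathbb{C})$ be a sesquiunital Schwarz map. Then for every positive semidefinite $A\in M_n(\mathbb{C})$ and every $B\in M_m(\mathbb{C})$, $$\operatorname{tr}\left[(\Phi(B)^*A^s\Phi(B))^{r/s}\right]\le \left(\frac{n}{m}\right)^{1-r}\operatorname{tr}\left[(B^*\Phi^\dagger(A)^sB)^{r/s}\right],$$ where real powers of positive semidefinite matrices are taken by functional calculus. -/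

import Mathlib

open scoped MatrixOrder ComplexOrder

/-- The adjoint `Φ†` of a linear map `Φ : M_m(ℂ) → M_n(ℂ)` with respect to the Hilbert–Schmidt
inner products `⟨X, Y⟩ = tr (Xᴴ Y)`. Its `(i, j)` entry at `Y` is `⟨Φ (E i j), Y⟩`, where the
`E i j` are the matrix units; `hsAdjoint_spec` and `hsAdjoint_unique` show that it is the adjoint. -/
def hsAdjoint {m n : ℕ} (Φ : Matrix (Fin m) (Fin m) ℂ →ₗ[ℂ] Matrix (Fin n) (Fin n) ℂ) :
    Matrix (Fin n) (Fin n) ℂ →ₗ[ℂ] Matrix (Fin m) (Fin m) ℂ where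
  toFun Y := Matrix.of fun i j => ((Φ (Matrix.single i j 1)).conjTranspose * Y).trace
  map_add' X Y := by
    ext i j
    simp [Matrix.mul_add, Matrix.trace_add]
  map_smul' c Y := by
    ext i j
    simp [Matrix.trace_smul]

theorem hsAdjoint_spec {m n : ℕ} (Φ : Matrix (Fin m) (Fin m) ℂ →ₗ[ℂ] Matrix (Fin n) (Fin n) ℂ)
    (X : Matrix (Fin m) (Fin m) ℂ) (Y : Matrix (Fin n) (Fin n) ℂ) :
    (X.conjTranspose * hsAdjoint Φ Y).trace = ((Φ X).conjTranspose * Y).trace := by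
  induction X using Matrix.induction_on' with
  | h_zero => simp
  | h_add p q hp hq => simp [Matrix.add_mul, Matrix.trace_add, hp, hq]
  | h_std_basis i j c =>
    have h : Matrix.single i j c = c • Matrix.single i j (1 : ℂ) := by simp
    rw [h, map_smul, Matrix.conjTranspose_smul, Matrix.conjTranspose_smul, Matrix.smul_mul,
      Matrix.smul_mul, Matrix.trace_smul, Matrix.trace_smul]
    congr 1
    simp [Matrix.conjTranspose_single, Matrix.trace_single_mul, hsAdjoint]

theorem hsAdjoint_unique {m n : ℕ} (Φ : Matrix (Fin m) (Fin m) ℂ →ₗ[ℂ] Matrix (Fin n) (Fin n) ℂ)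
    (Ψ : Matrix (Fin n) (Fin n) ℂ →ₗ[ℂ] Matrix (Fin m) (Fin m) ℂ)
    (h : ∀ X Y, (X.conjTranspose * Ψ Y).trace = ((Φ X).conjTranspose * Y).trace) :
    Ψ = hsAdjoint Φ := by
  refine LinearMap.ext fun Y => Matrix.ext fun i j => ?_
  have h1 := (h (Matrix.single i j 1) Y).trans (hsAdjoint_spec Φ (Matrix.single i j 1) Y).symm
  simpa [Matrix.conjTranspose_single, Matrix.trace_single_mul] using h1

/-- A linear map is a Schwarz map if `Φ (Xᴴ X) ≥ Φ(X)ᴴ Φ(X)` for all `X`, in the Loewner order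
(`A ≤ B` iff `B - A` is positive semidefinite). -/
def IsSchwarzMap {m n : ℕ} (Φ : Matrix (Fin m) (Fin m) ℂ →ₗ[ℂ] Matrix (Fin n) (Fin n) ℂ) : Prop :=
  ∀ X : Matrix (Fin m) (Fin m) ℂ, (Φ X).conjTranspose * Φ X ≤ Φ (X.conjTranspose * X)

/-- `Φ` is unital: `Φ(1) = 1`. -/
def IsUnital {m n : ℕ} (Φ : Matrix (Fin m) (Fin m) ℂ →ₗ[ℂ] Matrix (Fin n) (Fin n) ℂ) : Prop :=
  Φ 1 = 1

/-- `Φ` is semiunital: `Φ†(1) = (n / m) 1`. -/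
def IsSemiunital {m n : ℕ} (Φ : Matrix (Fin m) (Fin m) ℂ →ₗ[ℂ] Matrix (Fin n) (Fin n) ℂ) : Prop :=
  hsAdjoint Φ 1 = ((n : ℂ) / (m : ℂ)) • (1 : Matrix (Fin m) (Fin m) ℂ)

/-- `Φ` is sesquiunital: unital and semiunital. -/
def IsSesquiunital {m n : ℕ} (Φ : Matrix (Fin m) (Fin m) ℂ →ₗ[ℂ] Matrix (Fin n) (Fin n) ℂ) :
    Prop :=
  IsUnital Φ ∧ IsSemiunital Φ

/-!
Let `N` bound `Φ†(1)`, write `X = Φ(B)ᴴ A ^ s Φ(B)`, `Y = Bᴴ Φ†(A) ^ s B` and `p = r / s`.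

The trace function `tr (Kᴴ A ^ s K C ^ (1 - s))` is an integral over `t` of parallel sums of
`t⁻¹ • (A * ·)` and `(· * C)`, evaluated at `K`. A parallel sum is an infimal convolution of
quadratic forms, and the Schwarz inequality says exactly that each of the two forms at `Φ X` is at
most the corresponding form of the adjoint images at `X`. Hence
`tr (X C ^ (1 - s)) ≤ tr (Y Φ†(C) ^ (1 - s))` for all `C ≥ 0`.

Choosing `C` as the power of `X` with `X C ^ (1 - s) = X ^ p`, Hölder's inequality leaves
`(tr (Y ^ p)) ^ (1 / p)` times a power of `tr (Φ†(C) ^ q)`. Since `Φ†` does not increase the trace,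
a second use of Hölder, now for the positive map `Φ†`, gives
`tr (Φ†(C) ^ q) ≤ N ^ (q - 1) tr (C ^ q)`, and `tr (C ^ q)` is again `tr (X ^ p)`.
-/

section TracePairing

variable {ι : Type*} [Fintype ι] {A B C : Matrix ι ι ℂ}

theorem trace_mul_nonneg (hA : 0 ≤ A) (hB : 0 ≤ B) : 0 ≤ (A * B).trace := by
  classical
  obtain ⟨M, rfl⟩ := CStarAlgebra.nonneg_iff_eq_star_mul_self.1 hA
  rw [mul_assoc, Matrix.trace_mul_comm]
  exact ((Matrix.nonneg_iff_posSemidef.1 hB).mul_mul_conjTranspose_same M).trace_nonneg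

theorem re_trace_mul_nonneg (hA : 0 ≤ A) (hB : 0 ≤ B) : 0 ≤ (A * B).trace.re :=
  (Complex.le_def.1 (trace_mul_nonneg hA hB)).1

theorem re_trace_nonneg (hA : 0 ≤ A) : 0 ≤ A.trace.re :=
  (Complex.le_def.1 (Matrix.nonneg_iff_posSemidef.1 hA).trace_nonneg).1

theorem re_trace_mul_le_re_trace_mul (hA : 0 ≤ A) (hBC : B ≤ C) :
    (A * B).trace.re ≤ (A * C).trace.re := by
  simpa [mul_sub] using re_trace_mul_nonneg hA (sub_nonneg.2 hBC)

theorem nonneg_of_forall_trace_mul_nonneg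
    (h : ∀ B : Matrix ι ι ℂ, 0 ≤ B → 0 ≤ (A * B).trace) : 0 ≤ A := by
  classical
  rw [Matrix.nonneg_iff_posSemidef, ← Matrix.isPositive_toEuclideanLin_iff,
    LinearMap.isPositive_iff_complex]
  intro v
  have hv := h _ (Matrix.nonneg_iff_posSemidef.2 (Matrix.posSemidef_vecMulVec_self_star v.ofLp))
  rw [Matrix.mul_vecMulVec, Matrix.trace_vecMulVec] at hv
  have hinner : 0 ≤ inner ℂ (Matrix.toEuclideanLin A v) v := by
    rw [EuclideanSpace.inner_eq_star_dotProduct, dotProduct_comm, Matrix.star_dotProduct,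
      star_nonneg_iff, dotProduct_comm]
    exact hv
  obtain ⟨hre, him⟩ := Complex.le_def.1 hinner
  exact ⟨Complex.ext (by simp) (by simpa using him), hre⟩

end TracePairing

section Eigen

variable {ι κ : Type*} [Fintype ι] [DecidableEq ι] [Fintype κ] [DecidableEq κ]
  {A : Matrix ι ι ℂ} {C : Matrix κ κ ℂ}

/-- The orthogonal projection onto the line spanned by the `i`-th vector of an eigenbasis of `A`. -/
noncomputable def eigenprojection (hA : A.IsHermitian) (i : ι) : Matrix ι ι ℂ :=
  Matrix.vecMulVec (hA.eigenvectorBasis i) (star ⇑(hA.eigenvectorBasis i))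

theorem eigenprojection_nonneg (hA : A.IsHermitian) (i : ι) : 0 ≤ eigenprojection hA i :=
  (Matrix.posSemidef_vecMulVec_self_star _).nonneg

theorem cfc_eq_sum_smul_eigenprojection (hA : A.IsHermitian) (f : ℝ → ℝ) :
    cfc f A = ∑ i, f (hA.eigenvalues i) • eigenprojection hA i := by
  ext j k
  simp [eigenprojection, hA.cfc_eq, Matrix.IsHermitian.cfc, Unitary.conjStarAlgAut_apply,
    Matrix.mul_apply, Matrix.sum_apply, Matrix.vecMulVec_apply, Matrix.diagonal_apply, mul_assoc,
    mul_left_comm]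

theorem re_trace_cfc_mul_map_cfc (hA : A.IsHermitian) (hC : C.IsHermitian)
    (Ψ : Matrix κ κ ℂ →ₗ[ℂ] Matrix ι ι ℂ) (f g : ℝ → ℝ) :
    (cfc f A * Ψ (cfc g C)).trace.re = ∑ i, ∑ j, f (hA.eigenvalues i) * g (hC.eigenvalues j) *
      (eigenprojection hA i * Ψ (eigenprojection hC j)).trace.re := by
  simp only [cfc_eq_sum_smul_eigenprojection hA, cfc_eq_sum_smul_eigenprojection hC, map_sum,
    LinearMap.map_smul_of_tower, Finset.sum_mul_sum, smul_mul_smul_comm, Matrix.trace_sum,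
    Matrix.trace_smul, Complex.re_sum, Complex.smul_re, smul_eq_mul]

end Eigen

section Holder

variable {p q : ℝ}

theorem sum_mul_mul_le_rpow_mul_rpow {ι : Type*} (s : Finset ι) {w f g : ι → ℝ}
    (hpq : p.HolderConjugate q) (hw : ∀ i ∈ s, 0 ≤ w i) (hf : ∀ i ∈ s, 0 ≤ f i)
    (hg : ∀ i ∈ s, 0 ≤ g i) :
    ∑ i ∈ s, f i * g i * w i ≤
      (∑ i ∈ s, f i ^ p * w i) ^ (1 / p) * (∑ i ∈ s, g i ^ q * w i) ^ (1 / q) := by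
  have rpow_mul_rpow_inv {x y r : ℝ} (hx : 0 ≤ x) (hy : 0 ≤ y) (hr : r ≠ 0) :
      (x * y ^ r⁻¹) ^ r = x ^ r * y := by
    rw [Real.mul_rpow hx (Real.rpow_nonneg hy _), Real.rpow_inv_rpow hy hr]
  convert Real.inner_le_Lp_mul_Lq_of_nonneg s (f := fun i => f i * w i ^ p⁻¹)
    (g := fun i => g i * w i ^ q⁻¹) hpq
    (fun i hi => mul_nonneg (hf i hi) (Real.rpow_nonneg (hw i hi) _))
    (fun i hi => mul_nonneg (hg i hi) (Real.rpow_nonneg (hw i hi) _)) using 1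
  · refine Finset.sum_congr rfl fun i hi => ?_
    rw [mul_mul_mul_comm, ← Real.rpow_add' (hw i hi) (by simp [hpq.inv_add_inv_eq_one]),
      hpq.inv_add_inv_eq_one, Real.rpow_one]
  · congr 2 <;> refine Finset.sum_congr rfl fun i hi => ?_
    · rw [rpow_mul_rpow_inv (hf i hi) (hw i hi) hpq.ne_zero]
    · rw [rpow_mul_rpow_inv (hg i hi) (hw i hi) hpq.symm.ne_zero]

theorem le_rpow_mul_of_le_rpow_mul_rpow {T S M : ℝ} (hpq : p.HolderConjugate q) (hT : 0 ≤ T)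
    (hS : 0 ≤ S) (hM : 0 ≤ M) (h : T ≤ S ^ (1 / p) * (M * T) ^ (1 / q)) :
    T ≤ M ^ (p - 1) * S := by
  rcases hT.eq_or_lt with rfl | hT
  · positivity
  have hMT : 0 ≤ M * T := by positivity
  refine le_of_mul_le_mul_right ?_ (Real.rpow_pos_of_pos hT (p - 1))
  calc T * T ^ (p - 1) = T ^ p := by
        rw [Real.rpow_sub_one hT.ne', mul_div_cancel₀ _ hT.ne']
    _ ≤ (S ^ (1 / p) * (M * T) ^ (1 / q)) ^ p := Real.rpow_le_rpow hT.le h hpq.nonneg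
    _ = S * (M * T) ^ (p - 1) := by
        rw [Real.mul_rpow (by positivity) (by positivity), ← Real.rpow_mul hS,
          one_div_mul_cancel hpq.ne_zero, Real.rpow_one, ← Real.rpow_mul hMT, one_div_mul_eq_div,
          hpq.div_conj_eq_sub_one]
    _ = M ^ (p - 1) * S * T ^ (p - 1) := by
        rw [Real.mul_rpow hM hT.le]
        ring

variable {ι κ : Type*} [Fintype ι] [DecidableEq ι] [Fintype κ] [DecidableEq κ]

theorem mul_rpow_sub_one {A : Matrix ι ι ℂ} (hA : 0 ≤ A) (hp : p ≠ 0) :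
    A * A ^ (p - 1) = A ^ p := by
  rw [CFC.rpow_eq_cfc_real hA, CFC.rpow_eq_cfc_real hA]
  nth_rw 1 [← cfc_id' ℝ A]
  rw [← cfc_mul (hf := Matrix.finite_real_spectrum.continuousOn _)
    (hg := Matrix.finite_real_spectrum.continuousOn _)]
  refine cfc_congr fun x hx => ?_
  have hp' : 1 + (p - 1) ≠ 0 := by simpa using hp
  simpa using (Real.rpow_add' (spectrum_nonneg_of_nonneg hA hx) hp').symm

theorem rpow_le_smul_one {A : Matrix ι ι ℂ} {N : ℝ} (hA : 0 ≤ A) (hAN : A ≤ N • 1) (hp : 0 ≤ p) :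
    A ^ p ≤ N ^ p • (1 : Matrix ι ι ℂ) := by
  rw [← Algebra.algebraMap_eq_smul_one] at hAN ⊢
  rw [CFC.rpow_eq_cfc_real hA]
  refine cfc_le_algebraMap _ _ _ (fun x hx => ?_) (Matrix.finite_real_spectrum.continuousOn _)
  exact Real.rpow_le_rpow (spectrum_nonneg_of_nonneg hA hx)
    ((le_algebraMap_iff_spectrum_le (R := ℝ)).1 hAN x hx) hp

theorem re_trace_mul_map_le_rpow_mul_rpow (Ψ : Matrix κ κ ℂ →ₚ[ℂ] Matrix ι ι ℂ)
    {Y : Matrix ι ι ℂ} {D : Matrix κ κ ℂ} (hY : 0 ≤ Y) (hD : 0 ≤ D) (hpq : p.HolderConjugate q) :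
    (Y * Ψ D).trace.re ≤
      (Y ^ p * Ψ 1).trace.re ^ (1 / p) * (Ψ (D ^ q)).trace.re ^ (1 / q) := by
  have hY' := Matrix.nonneg_iff_posSemidef.1 hY
  have hD' := Matrix.nonneg_iff_posSemidef.1 hD
  have trace_eq (f g : ℝ → ℝ) :
      (cfc f Y * Ψ (cfc g D)).trace.re = ∑ x : ι × κ,
        f (hY'.1.eigenvalues x.1) * g (hD'.1.eigenvalues x.2) *
        (eigenprojection hY'.1 x.1 * Ψ (eigenprojection hD'.1 x.2)).trace.re :=
    (re_trace_cfc_mul_map_cfc hY'.1 hD'.1 Ψ.toLinearMap f g).trans (Fintype.sum_prod_type' _).symm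
  have h₁ := trace_eq id id
  have h₂ := trace_eq (· ^ p) 1
  have h₃ := trace_eq 1 (· ^ q)
  simp only [cfc_id ℝ Y, cfc_id ℝ D, ← CFC.rpow_eq_cfc_real hY, ← CFC.rpow_eq_cfc_real hD,
    cfc_one ℝ Y, cfc_one ℝ D, one_mul, mul_one, id, Pi.one_apply] at h₁ h₂ h₃
  rw [h₁, h₂, h₃]
  exact sum_mul_mul_le_rpow_mul_rpow _ hpq
    (fun x _ => re_trace_mul_nonneg (eigenprojection_nonneg _ _)
      (Ψ.map_nonneg (eigenprojection_nonneg _ _)))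
    (fun x _ => hY'.eigenvalues_nonneg x.1) (fun x _ => hD'.eigenvalues_nonneg x.2)

theorem re_trace_mul_le_rpow_mul_rpow {A B : Matrix ι ι ℂ} (hA : 0 ≤ A) (hB : 0 ≤ B)
    (hpq : p.HolderConjugate q) :
    (A * B).trace.re ≤ (A ^ p).trace.re ^ (1 / p) * (B ^ q).trace.re ^ (1 / q) := by
  simpa only [PositiveLinearMap.id_apply, mul_one] using
    re_trace_mul_map_le_rpow_mul_rpow (.id ℂ (Matrix ι ι ℂ)) hA hB hpq

theorem re_trace_map_rpow_le (Ψ : Matrix κ κ ℂ →ₚ[ℂ] Matrix ι ι ℂ) {N : ℝ} (hN : 0 ≤ N)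
    (hΨN : Ψ 1 ≤ N • 1) (hΨtr : ∀ C, 0 ≤ C → (Ψ C).trace.re ≤ C.trace.re)
    {C : Matrix κ κ ℂ} (hC : 0 ≤ C) (hq : 1 ≤ q) :
    (Ψ C ^ q).trace.re ≤ N ^ (q - 1) * (C ^ q).trace.re := by
  have hΨC : 0 ≤ Ψ C := Ψ.map_nonneg hC
  rcases hq.eq_or_lt with rfl | hq
  · simpa [CFC.rpow_one _ hC, CFC.rpow_one _ hΨC] using hΨtr C hC
  have hqq := Real.HolderConjugate.conjExponent hq
  refine le_rpow_mul_of_le_rpow_mul_rpow hqq (re_trace_nonneg CFC.rpow_nonneg)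
    (re_trace_nonneg CFC.rpow_nonneg) hN ?_
  have hpow : (Ψ C ^ (q - 1)) ^ q.conjExponent = Ψ C ^ q := by
    rw [CFC.rpow_rpow_of_exponent_nonneg (Ψ C) _ _ (sub_nonneg.2 hq.le) hqq.symm.nonneg hΨC,
      hqq.sub_one_mul_conj]
  have h₁ : (Ψ C ^ q * Ψ 1).trace.re ≤ N * (Ψ C ^ q).trace.re := by
    simpa using re_trace_mul_le_re_trace_mul (CFC.rpow_nonneg (a := Ψ C) (y := q)) hΨN
  have h₂ : (Ψ (C ^ q)).trace.re ≤ (C ^ q).trace.re := hΨtr _ CFC.rpow_nonneg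
  calc (Ψ C ^ q).trace.re = (Ψ C ^ (q - 1) * Ψ C).trace.re := by
        rw [Matrix.trace_mul_comm, mul_rpow_sub_one hΨC hqq.ne_zero]
    _ ≤ (Ψ C ^ q * Ψ 1).trace.re ^ (1 / q.conjExponent) * (Ψ (C ^ q)).trace.re ^ (1 / q) :=
        hpow ▸ re_trace_mul_map_le_rpow_mul_rpow Ψ CFC.rpow_nonneg hC hqq.symm
    _ ≤ (C ^ q).trace.re ^ (1 / q) * (N * (Ψ C ^ q).trace.re) ^ (1 / q.conjExponent) := by
        rw [mul_comm]
        have := re_trace_mul_nonneg (A := Ψ C ^ q) CFC.rpow_nonneg (Ψ.map_nonneg zero_le_one)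
        have := re_trace_nonneg (CFC.rpow_nonneg (a := C) (y := q))
        have := re_trace_nonneg (Ψ.map_nonneg (CFC.rpow_nonneg (a := C) (y := q)))
        have := hqq.nonneg
        have := hqq.symm.nonneg
        gcongr

end Holder

section PositiveMap

variable {m n : ℕ}

theorem trace_hsAdjoint_mul (Ψ : Matrix (Fin m) (Fin m) ℂ →ₚ[ℂ] Matrix (Fin n) (Fin n) ℂ)
    (Y : Matrix (Fin n) (Fin n) ℂ) (X : Matrix (Fin m) (Fin m) ℂ) :
    (hsAdjoint Ψ.toLinearMap Y * X).trace = (Y * Ψ X).trace := by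
  have h := hsAdjoint_spec Ψ.toLinearMap (star X) Y
  rw [PositiveLinearMap.coe_toLinearMap, map_star] at h
  rw [Matrix.star_eq_conjTranspose, Matrix.star_eq_conjTranspose,
    Matrix.conjTranspose_conjTranspose, Matrix.conjTranspose_conjTranspose] at h
  rw [Matrix.trace_mul_comm, h, Matrix.trace_mul_comm]

/-- The Hilbert–Schmidt adjoint of a positive map, as a positive map. -/
noncomputable def positiveAdjoint (Ψ : Matrix (Fin m) (Fin m) ℂ →ₚ[ℂ] Matrix (Fin n) (Fin n) ℂ) :
    Matrix (Fin n) (Fin n) ℂ →ₚ[ℂ] Matrix (Fin m) (Fin m) ℂ :=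
  .mk₀ (hsAdjoint Ψ.toLinearMap) fun Y hY => nonneg_of_forall_trace_mul_nonneg fun X hX => by
    rw [trace_hsAdjoint_mul]
    exact trace_mul_nonneg hY (Ψ.map_nonneg hX)

theorem re_trace_positiveAdjoint_le
    {Ψ : Matrix (Fin m) (Fin m) ℂ →ₚ[ℂ] Matrix (Fin n) (Fin n) ℂ} (hΨ : Ψ 1 ≤ 1)
    {C : Matrix (Fin n) (Fin n) ℂ} (hC : 0 ≤ C) :
    (positiveAdjoint Ψ C).trace.re ≤ C.trace.re := by
  have h := re_trace_mul_le_re_trace_mul hC hΨ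
  rwa [← trace_hsAdjoint_mul, mul_one, mul_one] at h

end PositiveMap

section SchwarzMap

variable {m n : ℕ} {Φ : Matrix (Fin m) (Fin m) ℂ →ₗ[ℂ] Matrix (Fin n) (Fin n) ℂ}
  {A C : Matrix (Fin n) (Fin n) ℂ}

theorem IsSchwarzMap.map_nonneg (hΦ : IsSchwarzMap Φ) {X : Matrix (Fin m) (Fin m) ℂ}
    (hX : 0 ≤ X) : 0 ≤ Φ X := by
  obtain ⟨M, rfl⟩ := CStarAlgebra.nonneg_iff_eq_star_mul_self.1 hX
  exact (star_mul_self_nonneg (Φ M)).trans (hΦ M)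

/-- A Schwarz map, as a positive map. -/
noncomputable def IsSchwarzMap.toPositiveLinearMap (hΦ : IsSchwarzMap Φ) :
    Matrix (Fin m) (Fin m) ℂ →ₚ[ℂ] Matrix (Fin n) (Fin n) ℂ :=
  .mk₀ Φ fun _ => hΦ.map_nonneg

theorem IsSchwarzMap.map_conjTranspose (hΦ : IsSchwarzMap Φ) (X : Matrix (Fin m) (Fin m) ℂ) :
    Φ X.conjTranspose = (Φ X).conjTranspose :=
  map_star hΦ.toPositiveLinearMap X

theorem IsSchwarzMap.mul_conjTranspose_le (hΦ : IsSchwarzMap Φ) (X : Matrix (Fin m) (Fin m) ℂ) :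
    Φ X * (Φ X).conjTranspose ≤ Φ (X * X.conjTranspose) := by
  simpa only [hΦ.map_conjTranspose, Matrix.conjTranspose_conjTranspose] using hΦ X.conjTranspose

theorem IsSchwarzMap.map_one_le (hΦ : IsSchwarzMap Φ) : Φ 1 ≤ 1 := by
  have hΦ1 : (Φ 1).conjTranspose = Φ 1 := by rw [← hΦ.map_conjTranspose, Matrix.conjTranspose_one]
  have hsq : Φ 1 * Φ 1 ≤ Φ 1 := by simpa [hΦ1] using hΦ 1
  rw [← sub_nonneg]
  calc 0 ≤ star (1 - Φ 1) * (1 - Φ 1) := star_mul_self_nonneg _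
    _ = 1 - Φ 1 - (Φ 1 - Φ 1 * Φ 1) := by
        rw [star_sub, star_one, Matrix.star_eq_conjTranspose, hΦ1]
        noncomm_ring
    _ ≤ 1 - Φ 1 := sub_le_self _ (sub_nonneg.2 hsq)

theorem IsSchwarzMap.hsAdjoint_nonneg (hΦ : IsSchwarzMap Φ) (hA : 0 ≤ A) : 0 ≤ hsAdjoint Φ A :=
  (positiveAdjoint hΦ.toPositiveLinearMap).map_nonneg hA

theorem IsSchwarzMap.re_trace_conjTranspose_mul_mul_le (hΦ : IsSchwarzMap Φ) (hA : 0 ≤ A)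
    (X : Matrix (Fin m) (Fin m) ℂ) :
    ((Φ X).conjTranspose * A * Φ X).trace.re ≤
      (X.conjTranspose * hsAdjoint Φ A * X).trace.re := by
  rw [Matrix.trace_mul_cycle, Matrix.trace_mul_cycle X.conjTranspose, Matrix.trace_mul_comm,
    Matrix.trace_mul_comm _ (hsAdjoint Φ A)]
  exact (re_trace_mul_le_re_trace_mul hA (hΦ.mul_conjTranspose_le X)).trans_eq
    (congrArg Complex.re (trace_hsAdjoint_mul hΦ.toPositiveLinearMap A _).symm)

theorem IsSchwarzMap.re_trace_conjTranspose_mul_self_mul_le (hΦ : IsSchwarzMap Φ) (hC : 0 ≤ C)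
    (X : Matrix (Fin m) (Fin m) ℂ) :
    ((Φ X).conjTranspose * Φ X * C).trace.re ≤
      (X.conjTranspose * X * hsAdjoint Φ C).trace.re := by
  rw [Matrix.trace_mul_comm, Matrix.trace_mul_comm _ (hsAdjoint Φ C)]
  exact (re_trace_mul_le_re_trace_mul hC (hΦ X)).trans_eq
    (congrArg Complex.re (trace_hsAdjoint_mul hΦ.toPositiveLinearMap C _).symm)

end SchwarzMap

section ParallelSumScalar

open MeasureTheory

variable {a c s t : ℝ}

theorem parallelSum_mul_normSq_add_le (ha : 0 ≤ a) (hc : 0 ≤ c) (ht : 0 < t) (x y : ℂ) :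
    a * c / (a + t * c) * Complex.normSq (x + y) ≤
      t⁻¹ * (a * Complex.normSq x) + c * Complex.normSq y := by
  rcases (add_nonneg ha (mul_nonneg ht.le hc)).eq_or_lt' with h0 | h0
  · have := Complex.normSq_nonneg x
    have := Complex.normSq_nonneg y
    rw [h0, div_zero, zero_mul]
    positivity
  · have hdiff : t⁻¹ * (a * Complex.normSq x) + c * Complex.normSq y -
        a * c / (a + t * c) * Complex.normSq (x + y) =
          t⁻¹ * Complex.normSq (a * x - t * c * y) / (a + t * c) := by
      simp only [Complex.normSq_apply, Complex.add_re, Complex.add_im, Complex.sub_re,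
        Complex.sub_im, Complex.mul_re, Complex.mul_im, Complex.ofReal_re, Complex.ofReal_im]
      field_simp
      ring
    have := Complex.normSq_nonneg (a * x - t * c * y)
    rw [← sub_nonneg, hdiff]
    positivity

theorem exists_add_eq_parallelSum_mul_normSq (ha : 0 ≤ a) (hc : 0 ≤ c) (ht : 0 < t) (k : ℂ) :
    ∃ x y : ℂ, x + y = k ∧ t⁻¹ * (a * Complex.normSq x) + c * Complex.normSq y =
      a * c / (a + t * c) * Complex.normSq k := by
  rcases (add_nonneg ha (mul_nonneg ht.le hc)).eq_or_lt' with h0 | h0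
  · have hc0 : c = 0 := by nlinarith [mul_nonneg ht.le hc]
    exact ⟨0, k, by simp, by simp [hc0]⟩
  · refine ⟨(t * c / (a + t * c) : ℝ) * k, (a / (a + t * c) : ℝ) * k, ?_, ?_⟩
    · rw [← add_mul, ← Complex.ofReal_add, ← add_div, add_comm (t * c), div_self h0.ne',
        Complex.ofReal_one, one_mul]
    · rw [Complex.normSq_mul, Complex.normSq_mul, Complex.normSq_ofReal, Complex.normSq_ofReal]
      field_simp
      ring

theorem mul_rpowIntegrand₀₁_div (hs : s ∈ Set.Ioo 0 1) (ht : 0 < t) (ha : 0 ≤ a) (hc : 0 ≤ c) :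
    c * Real.rpowIntegrand₀₁ s t (a / c) = t ^ (s - 1) * (a * c / (a + t * c)) := by
  rcases hc.eq_or_lt' with rfl | hc
  · simp
  · rw [Real.rpowIntegrand₀₁_eq_pow_div hs ht.le (by positivity)]
    field_simp
    ring

theorem integrableOn_rpow_mul_parallelSum (hs : s ∈ Set.Ioo 0 1) (ha : 0 ≤ a) (hc : 0 ≤ c) :
    IntegrableOn (fun t => t ^ (s - 1) * (a * c / (a + t * c))) (Set.Ioi 0) :=
  IntegrableOn.congr_fun
    ((Real.integrableOn_rpowIntegrand₀₁_Ioi hs (div_nonneg ha hc)).const_mul c)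
    (fun _ ht => mul_rpowIntegrand₀₁_div hs ht ha hc) measurableSet_Ioi

theorem integral_rpow_mul_parallelSum (hs : s ∈ Set.Ioo 0 1) (ha : 0 ≤ a) (hc : 0 ≤ c) :
    ∫ t in Set.Ioi 0, t ^ (s - 1) * (a * c / (a + t * c)) =
      a ^ s * c ^ (1 - s) * ∫ t in Set.Ioi 0, Real.rpowIntegrand₀₁ s t 1 := by
  rw [← setIntegral_congr_fun measurableSet_Ioi
      fun _ ht => mul_rpowIntegrand₀₁_div hs ht ha hc,
    integral_const_mul, Real.integral_rpowIntegrand₀₁_eq_rpow_mul_const hs (by positivity),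
    ← mul_assoc]
  congr 1
  rcases hc.eq_or_lt' with rfl | hc
  · rw [Real.zero_rpow (by linarith [hs.2]), zero_mul, mul_zero]
  · rw [Real.div_rpow ha hc.le, Real.rpow_sub hc, Real.rpow_one]
    ring

end ParallelSumScalar

section ParallelSumForm

open MeasureTheory

variable {ι κ : Type*} [Fintype ι] [DecidableEq ι] [Fintype κ] [DecidableEq κ]
  {A : Matrix ι ι ℂ} {C : Matrix κ κ ℂ}

/-- The coordinates of a rectangular matrix `K` with respect to eigenbases of the Hermitian
matrices `A` and `C`: they diagonalize left multiplication by `A` and right multiplication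
by `C` simultaneously. -/
noncomputable def eigenCoords (hA : A.IsHermitian) (hC : C.IsHermitian) :
    Matrix ι κ ℂ ≃+ Matrix ι κ ℂ where
  toFun K := star (hA.eigenvectorUnitary : Matrix ι ι ℂ) * K *
    (hC.eigenvectorUnitary : Matrix κ κ ℂ)
  invFun Z := (hA.eigenvectorUnitary : Matrix ι ι ℂ) * Z *
    star (hC.eigenvectorUnitary : Matrix κ κ ℂ)
  left_inv K := by
    beta_reduce
    rw [Matrix.mul_assoc, Matrix.mul_assoc (_ * K),
      Unitary.mul_star_self_of_mem hC.eigenvectorUnitary.2, Matrix.mul_one, ← Matrix.mul_assoc,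
      Unitary.mul_star_self_of_mem hA.eigenvectorUnitary.2, Matrix.one_mul]
  right_inv Z := by
    beta_reduce
    rw [Matrix.mul_assoc, Matrix.mul_assoc (_ * Z), Unitary.coe_star_mul_self, Matrix.mul_one,
      ← Matrix.mul_assoc, Unitary.coe_star_mul_self, Matrix.one_mul]
  map_add' K L := by rw [Matrix.mul_add, Matrix.add_mul]

theorem re_trace_conjTranspose_mul_diagonal_mul_mul_diagonal (a : ι → ℝ) (c : κ → ℝ)
    (Z : Matrix ι κ ℂ) :
    (Z.conjTranspose * Matrix.diagonal (fun i => (a i : ℂ)) * Z *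
      Matrix.diagonal (fun j => (c j : ℂ))).trace.re =
      ∑ i, ∑ j, a i * c j * Complex.normSq (Z i j) := by
  rw [Matrix.trace, Complex.re_sum, Finset.sum_comm]
  refine Finset.sum_congr rfl fun j _ => ?_
  rw [Matrix.diag_apply, Matrix.mul_diagonal, Matrix.mul_apply, Finset.sum_mul, Complex.re_sum]
  refine Finset.sum_congr rfl fun i _ => ?_
  simp only [Matrix.mul_diagonal, Matrix.conjTranspose_apply, Complex.star_def, Complex.mul_re,
    Complex.mul_im, Complex.conj_re, Complex.conj_im, Complex.ofReal_re, Complex.ofReal_im,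
    Complex.normSq_apply]
  ring

theorem re_trace_conjTranspose_mul_cfc_mul_cfc (hA : A.IsHermitian) (hC : C.IsHermitian)
    (f g : ℝ → ℝ) (K : Matrix ι κ ℂ) :
    (K.conjTranspose * cfc f A * K * cfc g C).trace.re =
      ∑ i, ∑ j, f (hA.eigenvalues i) * g (hC.eigenvalues j) *
        Complex.normSq (eigenCoords hA hC K i j) := by
  rw [← re_trace_conjTranspose_mul_diagonal_mul_mul_diagonal, hA.cfc_eq, hC.cfc_eq,
    Matrix.IsHermitian.cfc, Matrix.IsHermitian.cfc, Unitary.conjStarAlgAut_apply,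
    Unitary.conjStarAlgAut_apply, ← Matrix.mul_assoc, Matrix.trace_mul_comm]
  simp [eigenCoords, Matrix.mul_assoc, Matrix.star_eq_conjTranspose, Function.comp_def]

/-- The quadratic form at `K` of the parallel sum of `t⁻¹ • (A * ·)` and `(· * C)`, two commuting
positive operators on rectangular matrices. A summand whose denominator vanishes is zero, since
then `a i = c j = 0`. -/
noncomputable def parallelSumForm (hA : A.IsHermitian) (hC : C.IsHermitian) (t : ℝ)
    (K : Matrix ι κ ℂ) : ℝ :=
  ∑ i, ∑ j, hA.eigenvalues i * hC.eigenvalues j / (hA.eigenvalues i + t * hC.eigenvalues j) *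
    Complex.normSq (eigenCoords hA hC K i j)

theorem re_trace_add_re_trace_eq_sum (hA : A.IsHermitian) (hC : C.IsHermitian) (t : ℝ)
    (X Y : Matrix ι κ ℂ) :
    t⁻¹ * (X.conjTranspose * A * X).trace.re + (Y.conjTranspose * Y * C).trace.re =
      ∑ i, ∑ j, (t⁻¹ * (hA.eigenvalues i * Complex.normSq (eigenCoords hA hC X i j)) +
        hC.eigenvalues j * Complex.normSq (eigenCoords hA hC Y i j)) := by
  have hX := re_trace_conjTranspose_mul_cfc_mul_cfc hA hC id 1 X
  have hY := re_trace_conjTranspose_mul_cfc_mul_cfc hA hC 1 id Y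
  rw [cfc_id ℝ A, cfc_one ℝ C, Matrix.mul_one] at hX
  rw [cfc_id ℝ C, cfc_one ℝ A, Matrix.mul_one] at hY
  simp only [hX, hY, id, Pi.one_apply, mul_one, one_mul, Finset.sum_add_distrib, Finset.mul_sum]

theorem parallelSumForm_add_le (hA : A.PosSemidef) (hC : C.PosSemidef) {t : ℝ} (ht : 0 < t)
    (X Y : Matrix ι κ ℂ) :
    parallelSumForm hA.1 hC.1 t (X + Y) ≤
      t⁻¹ * (X.conjTranspose * A * X).trace.re + (Y.conjTranspose * Y * C).trace.re := by
  rw [re_trace_add_re_trace_eq_sum hA.1 hC.1, parallelSumForm, map_add]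
  exact Finset.sum_le_sum fun i _ => Finset.sum_le_sum fun j _ =>
    parallelSum_mul_normSq_add_le (hA.eigenvalues_nonneg i) (hC.eigenvalues_nonneg j) ht _ _

theorem exists_add_eq_parallelSumForm (hA : A.PosSemidef) (hC : C.PosSemidef) {t : ℝ}
    (ht : 0 < t) (K : Matrix ι κ ℂ) :
    ∃ X Y, X + Y = K ∧
      t⁻¹ * (X.conjTranspose * A * X).trace.re + (Y.conjTranspose * Y * C).trace.re =
        parallelSumForm hA.1 hC.1 t K := by
  choose x y hxy heq using fun i j => exists_add_eq_parallelSum_mul_normSq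
    (hA.eigenvalues_nonneg i) (hC.eigenvalues_nonneg j) ht (eigenCoords hA.1 hC.1 K i j)
  refine ⟨(eigenCoords hA.1 hC.1).symm (.of x), (eigenCoords hA.1 hC.1).symm (.of y), ?_, ?_⟩
  · rw [← map_add, AddEquiv.symm_apply_eq]
    ext i j
    exact hxy i j
  · simp only [re_trace_add_re_trace_eq_sum hA.1 hC.1, AddEquiv.apply_symm_apply,
      Matrix.of_apply, heq, parallelSumForm]

theorem integrableOn_rpow_mul_parallelSumForm (hA : A.PosSemidef) (hC : C.PosSemidef) {s : ℝ}
    (hs : s ∈ Set.Ioo 0 1) (K : Matrix ι κ ℂ) :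
    IntegrableOn (fun t => t ^ (s - 1) * parallelSumForm hA.1 hC.1 t K) (Set.Ioi 0) := by
  simp only [parallelSumForm, Finset.mul_sum, ← mul_assoc (_ ^ (s - 1))]
  exact integrable_finsetSum _ fun i _ => integrable_finsetSum _ fun j _ =>
    (integrableOn_rpow_mul_parallelSum hs (hA.eigenvalues_nonneg i)
      (hC.eigenvalues_nonneg j)).mul_const _

theorem integral_rpow_mul_parallelSumForm (hA : A.PosSemidef) (hC : C.PosSemidef) {s : ℝ}
    (hs : s ∈ Set.Ioo 0 1) (K : Matrix ι κ ℂ) :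
    ∫ t in Set.Ioi 0, t ^ (s - 1) * parallelSumForm hA.1 hC.1 t K =
      (K.conjTranspose * A ^ s * K * C ^ (1 - s)).trace.re *
        ∫ t in Set.Ioi 0, Real.rpowIntegrand₀₁ s t 1 := by
  have hint (i j) := (integrableOn_rpow_mul_parallelSum hs (hA.eigenvalues_nonneg i)
      (hC.eigenvalues_nonneg j)).mul_const (Complex.normSq (eigenCoords hA.1 hC.1 K i j))
  simp only [parallelSumForm, Finset.mul_sum, ← mul_assoc (_ ^ (s - 1))]
  rw [CFC.rpow_eq_cfc_real hA.nonneg, CFC.rpow_eq_cfc_real hC.nonneg,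
    re_trace_conjTranspose_mul_cfc_mul_cfc hA.1 hC.1,
    integral_finsetSum _ fun i _ => integrable_finsetSum _ fun j _ => hint i j, Finset.sum_mul]
  refine Finset.sum_congr rfl fun i _ => ?_
  rw [integral_finsetSum _ fun j _ => hint i j, Finset.sum_mul]
  refine Finset.sum_congr rfl fun j _ => ?_
  rw [integral_mul_const, integral_rpow_mul_parallelSum hs (hA.eigenvalues_nonneg i)
    (hC.eigenvalues_nonneg j), mul_right_comm]

end ParallelSumForm

section Lieb

variable {m n : ℕ} {Φ : Matrix (Fin m) (Fin m) ℂ →ₗ[ℂ] Matrix (Fin n) (Fin n) ℂ}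
  {A C : Matrix (Fin n) (Fin n) ℂ} {s : ℝ}

theorem IsSchwarzMap.parallelSumForm_le (hΦ : IsSchwarzMap Φ) (hA : A.PosSemidef)
    (hC : C.PosSemidef) (hΦA : (hsAdjoint Φ A).PosSemidef) (hΦC : (hsAdjoint Φ C).PosSemidef)
    {t : ℝ} (ht : 0 < t) (B : Matrix (Fin m) (Fin m) ℂ) :
    parallelSumForm hA.1 hC.1 t (Φ B) ≤ parallelSumForm hΦA.1 hΦC.1 t B := by
  obtain ⟨X, Y, rfl, hXY⟩ := exists_add_eq_parallelSumForm hΦA hΦC ht B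
  rw [map_add, ← hXY]
  refine (parallelSumForm_add_le hA hC ht (Φ X) (Φ Y)).trans ?_
  exact add_le_add
    (mul_le_mul_of_nonneg_left (hΦ.re_trace_conjTranspose_mul_mul_le hA.nonneg X) (by positivity))
    (hΦ.re_trace_conjTranspose_mul_self_mul_le hC.nonneg Y)

theorem IsSchwarzMap.re_trace_rpow_mul_rpow_le (hΦ : IsSchwarzMap Φ) (hs : s ∈ Set.Icc 0 1)
    (hA : 0 ≤ A) (hC : 0 ≤ C) (B : Matrix (Fin m) (Fin m) ℂ) :
    ((Φ B).conjTranspose * A ^ s * Φ B * C ^ (1 - s)).trace.re ≤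
      (B.conjTranspose * hsAdjoint Φ A ^ s * B * hsAdjoint Φ C ^ (1 - s)).trace.re := by
  have hΦA := hΦ.hsAdjoint_nonneg hA
  have hΦC := hΦ.hsAdjoint_nonneg hC
  rcases hs.1.eq_or_lt with rfl | hs0
  · simpa [CFC.rpow_zero, CFC.rpow_one, hA, hC, hΦA, hΦC] using
      hΦ.re_trace_conjTranspose_mul_self_mul_le hC B
  rcases hs.2.eq_or_lt with rfl | hs1
  · simpa [CFC.rpow_zero, CFC.rpow_one, hA, hC, hΦA, hΦC] using
      hΦ.re_trace_conjTranspose_mul_mul_le hA B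
  have hs : s ∈ Set.Ioo 0 1 := ⟨hs0, hs1⟩
  rw [Matrix.nonneg_iff_posSemidef] at hA hC hΦA hΦC
  refine le_of_mul_le_mul_right ?_ (Real.integral_rpowIntegrand₀₁_one_pos hs)
  rw [← integral_rpow_mul_parallelSumForm hA hC hs, ← integral_rpow_mul_parallelSumForm hΦA hΦC hs]
  refine MeasureTheory.setIntegral_mono_on (integrableOn_rpow_mul_parallelSumForm hA hC hs _)
    (integrableOn_rpow_mul_parallelSumForm hΦA hΦC hs _) measurableSet_Ioi fun t ht => ?_
  exact mul_le_mul_of_nonneg_left (hΦ.parallelSumForm_le hA hC hΦA hΦC ht B)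
    (Real.rpow_nonneg (le_of_lt ht) _)

end Lieb

section TraceInequality

variable {m n : ℕ} {Φ : Matrix (Fin m) (Fin m) ℂ →ₗ[ℂ] Matrix (Fin n) (Fin n) ℂ}
  {A C : Matrix (Fin n) (Fin n) ℂ} {N p q s : ℝ}

theorem IsSchwarzMap.re_trace_conjTranspose_mul_rpow_mul_le (hΦ : IsSchwarzMap Φ)
    (hs : s ∈ Set.Icc 0 1) (hΦN : hsAdjoint Φ 1 ≤ N • 1) (hA : 0 ≤ A)
    (B : Matrix (Fin m) (Fin m) ℂ) :
    ((Φ B).conjTranspose * A ^ s * Φ B).trace.re ≤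
      N ^ (1 - s) * (B.conjTranspose * hsAdjoint Φ A ^ s * B).trace.re := by
  have hY : 0 ≤ B.conjTranspose * hsAdjoint Φ A ^ s * B :=
    star_left_conjugate_nonneg CFC.rpow_nonneg B
  have hpow := rpow_le_smul_one (hΦ.hsAdjoint_nonneg zero_le_one) hΦN (sub_nonneg.2 hs.2)
  calc ((Φ B).conjTranspose * A ^ s * Φ B).trace.re
      ≤ (B.conjTranspose * hsAdjoint Φ A ^ s * B * hsAdjoint Φ 1 ^ (1 - s)).trace.re := by
        simpa only [CFC.one_rpow, mul_one] using hΦ.re_trace_rpow_mul_rpow_le hs hA zero_le_one B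
    _ ≤ (B.conjTranspose * hsAdjoint Φ A ^ s * B * N ^ (1 - s) • 1).trace.re :=
        re_trace_mul_le_re_trace_mul hY hpow
    _ = N ^ (1 - s) * (B.conjTranspose * hsAdjoint Φ A ^ s * B).trace.re := by simp

theorem IsSchwarzMap.re_trace_hsAdjoint_rpow_le (hΦ : IsSchwarzMap Φ) (hN : 0 ≤ N)
    (hΦN : hsAdjoint Φ 1 ≤ N • 1) (hC : 0 ≤ C) (hq : 1 ≤ q) :
    (hsAdjoint Φ C ^ q).trace.re ≤ N ^ (q - 1) * (C ^ q).trace.re := by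
  have hpos (D) : positiveAdjoint hΦ.toPositiveLinearMap D = hsAdjoint Φ D := rfl
  have h := re_trace_map_rpow_le (positiveAdjoint hΦ.toPositiveLinearMap) hN
    (by rwa [hpos]) (fun _ => re_trace_positiveAdjoint_le hΦ.map_one_le) hC hq
  rwa [hpos] at h

theorem IsSchwarzMap.re_trace_mul_hsAdjoint_rpow_le (hΦ : IsSchwarzMap Φ) (hN : 0 ≤ N)
    (hΦN : hsAdjoint Φ 1 ≤ N • 1) (hpq : p.HolderConjugate q) {u : ℝ} (hu : 0 ≤ u)
    (huq : 1 ≤ u * q) {Y : Matrix (Fin m) (Fin m) ℂ} (hY : 0 ≤ Y) (hC : 0 ≤ C) :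
    (Y * hsAdjoint Φ C ^ u).trace.re ≤
      (Y ^ p).trace.re ^ (1 / p) * (N ^ (u * q - 1) * (C ^ (u * q)).trace.re) ^ (1 / q) := by
  have hYp : 0 ≤ (Y ^ p).trace.re := re_trace_nonneg CFC.rpow_nonneg
  have hΦCq : 0 ≤ (hsAdjoint Φ C ^ (u * q)).trace.re := re_trace_nonneg CFC.rpow_nonneg
  have hq := hpq.symm.one_div_nonneg
  calc (Y * hsAdjoint Φ C ^ u).trace.re
      ≤ (Y ^ p).trace.re ^ (1 / p) * (hsAdjoint Φ C ^ (u * q)).trace.re ^ (1 / q) := by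
        rw [← CFC.rpow_rpow_of_exponent_nonneg (hsAdjoint Φ C) u q hu hpq.symm.nonneg
          (hΦ.hsAdjoint_nonneg hC)]
        exact re_trace_mul_le_rpow_mul_rpow hY CFC.rpow_nonneg hpq
    _ ≤ (Y ^ p).trace.re ^ (1 / p) *
          (N ^ (u * q - 1) * (C ^ (u * q)).trace.re) ^ (1 / q) := by
        gcongr
        exact hΦ.re_trace_hsAdjoint_rpow_le hN hΦN hC huq

theorem theorem3p3_general (hΦ : IsSchwarzMap Φ) (hN : 0 ≤ N) (hΦN : hsAdjoint Φ 1 ≤ N • 1)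
    (hs : 0 ≤ s) (hp : 1 ≤ p) (hsp : s * p ≤ 1) (hA : 0 ≤ A) (B : Matrix (Fin m) (Fin m) ℂ) :
    (((Φ B).conjTranspose * A ^ s * Φ B) ^ p).trace.re ≤
      N ^ (1 - s * p) * ((B.conjTranspose * hsAdjoint Φ A ^ s * B) ^ p).trace.re := by
  set X := (Φ B).conjTranspose * A ^ s * Φ B
  set Y := B.conjTranspose * hsAdjoint Φ A ^ s * B
  have hX : 0 ≤ X := star_left_conjugate_nonneg CFC.rpow_nonneg (Φ B)
  have hY : 0 ≤ Y := star_left_conjugate_nonneg CFC.rpow_nonneg B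
  rcases hp.eq_or_lt with rfl | hp
  · rw [mul_one] at hsp ⊢
    rw [CFC.rpow_one X hX, CFC.rpow_one Y hY]
    exact hΦ.re_trace_conjTranspose_mul_rpow_mul_le ⟨hs, hsp⟩ hΦN hA B
  have hs1 : 0 < 1 - s := by nlinarith
  have hpq := Real.HolderConjugate.conjExponent hp
  set q := p.conjExponent
  have hexp : ((1 - s) * q - 1) * (p - 1) = 1 - s * p := by
    linear_combination (1 - s) * hpq.sub_one_mul_conj
  have hq : 1 ≤ (1 - s) * q := by
    rw [← sub_nonneg]
    exact nonneg_of_mul_nonneg_left (hexp ▸ sub_nonneg.2 hsp) hpq.sub_one_pos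
  have hXpow {u : ℝ} (hu : 0 ≤ u) : (X ^ ((p - 1) / (1 - s))) ^ u = X ^ ((p - 1) / (1 - s) * u) :=
    CFC.rpow_rpow_of_exponent_nonneg X _ _ (div_nonneg hpq.sub_one_pos.le hs1.le) hu hX
  rw [← hexp, Real.rpow_mul hN]
  refine le_rpow_mul_of_le_rpow_mul_rpow hpq (re_trace_nonneg CFC.rpow_nonneg)
    (re_trace_nonneg CFC.rpow_nonneg) (Real.rpow_nonneg hN _) ?_
  calc (X ^ p).trace.re = (X * (X ^ ((p - 1) / (1 - s))) ^ (1 - s)).trace.re := by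
        rw [hXpow hs1.le, div_mul_cancel₀ _ hs1.ne', mul_rpow_sub_one hX hpq.ne_zero]
    _ ≤ (Y * hsAdjoint Φ (X ^ ((p - 1) / (1 - s))) ^ (1 - s)).trace.re :=
        hΦ.re_trace_rpow_mul_rpow_le ⟨hs, by linarith⟩ hA CFC.rpow_nonneg B
    _ ≤ (Y ^ p).trace.re ^ (1 / p) * (N ^ ((1 - s) * q - 1) *
          ((X ^ ((p - 1) / (1 - s))) ^ ((1 - s) * q)).trace.re) ^ (1 / q) :=
        hΦ.re_trace_mul_hsAdjoint_rpow_le hN hΦN hpq hs1.le hq hY CFC.rpow_nonneg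
    _ = (Y ^ p).trace.re ^ (1 / p) *
          (N ^ ((1 - s) * q - 1) * (X ^ p).trace.re) ^ (1 / q) := by
        rw [hXpow (by linarith), ← mul_assoc, div_mul_cancel₀ _ hs1.ne', hpq.sub_one_mul_conj]

end TraceInequality

theorem IsSemiunital.hsAdjoint_one_eq {m n : ℕ}
    {Φ : Matrix (Fin m) (Fin m) ℂ →ₗ[ℂ] Matrix (Fin n) (Fin n) ℂ} (hΦ : IsSemiunital Φ) :
    hsAdjoint Φ 1 = ((n : ℝ) / (m : ℝ)) • (1 : Matrix (Fin m) (Fin m) ℂ) := by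
  rw [← Complex.coe_smul]
  push_cast
  exact hΦ

theorem theorem3p3 {m n : ℕ} (hm : 0 < m) (hn : 0 < n) {s r : ℝ}
    (hs : 0 < s) (hs1 : s ≤ 1) (hsr : s ≤ r) (hr1 : r ≤ 1)
    (Φ : Matrix (Fin m) (Fin m) ℂ →ₗ[ℂ] Matrix (Fin n) (Fin n) ℂ)
    (hΦ : IsSchwarzMap Φ) (hΦ1 : IsSesquiunital Φ)
    (A : Matrix (Fin n) (Fin n) ℂ) (hA : A.PosSemidef) (B : Matrix (Fin m) (Fin m) ℂ) :
    (((Φ B).conjTranspose * A ^ s * Φ B) ^ (r / s)).trace.re ≤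
      ((n : ℝ) / (m : ℝ)) ^ (1 - r) *
        ((B.conjTranspose * (hsAdjoint Φ A) ^ s * B) ^ (r / s)).trace.re := by
  have hsp : s * (r / s) = r := mul_div_cancel₀ r hs.ne'
  simpa only [hsp] using theorem3p3_general hΦ (by positivity) hΦ1.2.hsAdjoint_one_eq.le hs.le
    ((one_le_div hs).2 hsr) (hsp.trans_le hr1) hA.nonneg B
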